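/- An uncertain point in $\mathbb{R}$ with $k$ locations is a list $p=(p_1,\dots,p_k)$ of reals; its random position equals each $p_j$ with probability $1/k$. For a nonempty finite family $P=\{p^{(1)},\dots,p^{(n)}\}$ of uncertain points with $k$ locations each, let $Q=(q_1,\dots,q_n)$ be the random vector of their independently drawn positions, and for $r\subseteq\mathbb{R}$ and $\tau\in[0,1]$ let $$G_{P,r}(\tau)=\frac1{|P|}\,\bigl|\{\,i : \Pr_Q[q_i\in r]\ge\tau\,\}\bigr| .$$ A nonempty subfamily $T\subseteq P$ is an $\varepsilon$-RC coreset of $(P,\mathcal I)$, where $\mathcal I$ is the set of all closed intervals $[a,b]$ with $a\le b$ real, if $|G_{P,r}(\tau)-G_{T,r}(\tau)|\le\varepsilon$ for all $r\in\mathcal I$ and all $\tau\in[0,1]$. Theorem. There is an absolute constant $C>0$ such that for all integers $k,n\ge1$, all $\varepsilon\in(0,1]$ with $k/\varepsilon\ge2$, and every family $P$ of $n$ uncertain points in $\mathbb{R}$ with $k$ locations each, there is an $\varepsilon$-RC coreset $T\subseteq P$ of $(P,\mathcal I)$ with $$|T|\le C\,\frac{k^2}{\varepsilon}\,\log^4\!\Bigl(\frac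 k\varepsilon\Bigr).$$ -/

import Mathlib

open MeasureTheory

/-- An uncertain point on the real line with `k` possible locations `loc 0, …, loc (k - 1)`, each of
them taken with probability `1 / k`. (Coinciding locations are not excluded.) -/
structure UncertainPoint (k : ℕ) where
  loc : Fin k → ℝ

/-- The law of the random location of an uncertain point. -/
noncomputable def UncertainPoint.law {k : ℕ} (p : UncertainPoint k) : Measure ℝ :=
  (ProbabilityTheory.uniformOn (Set.univ : Set (Fin k))).map p.loc

/-- The law of a random transversal `Q = (q_i)` of the uncertain point set `P = (p_i)`: the locations
`q_i` of the points `p_i` are drawn independently. -/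
noncomputable def transversalLaw {ι : Type} [Fintype ι] {k : ℕ} (P : ι → UncertainPoint k) :
    Measure (ι → ℝ) :=
  Measure.pi fun i => (P i).law

/-- `G_{P,r}(τ)`: the fraction of the points `p_i` of `P` with `Pr_Q [q_i ∈ r] ≥ τ`, where `Q` is a
random transversal of `P`. -/
noncomputable def rcFraction {ι : Type} [Fintype ι] {k : ℕ} (P : ι → UncertainPoint k)
    (r : Set ℝ) (τ : ℝ) : ℝ :=
  (Nat.card {i : ι // τ ≤ (transversalLaw P).real {Q : ι → ℝ | Q i ∈ r}} : ℝ) / Fintype.card ι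

/-- `T ⊆ P` (given by the set of indices of its points) is an `ε`-RC coreset of `(P, A)`:
`|G_{P,r}(τ) - G_{T,r}(τ)| ≤ ε` for all ranges `r ∈ A` and all thresholds `τ ∈ [0,1]`. -/
def IsRCCoreset {ι : Type} [Fintype ι] {k : ℕ} (ε : ℝ) (P : ι → UncertainPoint k)
    (A : Set (Set ℝ)) (T : Finset ι) : Prop :=
  T.Nonempty ∧ ∀ r ∈ A, ∀ τ ∈ Set.Icc (0 : ℝ) 1,
    |rcFraction P r τ - rcFraction (fun i : T => P i) r τ| ≤ ε

/-- The family of two-sided intervals `[a, b]` of the real line. -/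
def twoSidedIntervals : Set (Set ℝ) :=
  {r | ∃ a b : ℝ, a ≤ b ∧ r = Set.Icc a b}

/-!
A range `[a, b]` and a threshold `τ > 0` select the points with more than `j` locations in `[a, b]`,
for some `j < k` (`isRCCoreset_of_heavy`). So it suffices to thin out the family while all the
fractions of such *heavy* points are kept up to `ε`. This is done by halving: colour the points with
two signs so that every set of heavy points, and the whole family, is nearly balanced, keep the
smaller class, and repeat (`exists_iterated_halving`). If the colourings of `m` points have
discrepancy `D = O(k² log⁴ (m k))`, the relative errors `D / m` grow geometrically from one halving
to the next, so one may stop at `m` of the order of `(k² / ε) log⁴ (k / ε)`.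

The colouring (`exists_signs_staircase`) comes from the Beck–Fiala theorem for real matrices
(`beck_fiala`): if all columns have `ℓ¹`-norm at most `t`, some signing has all row sums at most
`2 t`. Replace `a` and `b` by ranks `u` and `v` below `2 ^ h` among the locations. For each point and
each `j`, the pairs `(u, v)` for which it is heavy form a staircase region of the plane. The
indicator of that region at `(u, v)` is the sum of its mixed second differences over `h²` rectangles
of dyadic blocks (`eq_sum_mixedDiff`), and the rows of the matrix are these mixed differences.
The column norm has to be counted economically: a rectangle whose sides contain `A` and `B` of the
ranks of a point carries a total variation of at most `2 min (A, B) ≤ 2 A B` over all the `j`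
together (`sum_abs_mixedDiff_staircase_le`), and each rank lies in at most `h` blocks, so `t` is of
the order of `k² h²` (`sum_sum_abs_mixedDiff_staircase_le`). Decomposing each staircase into quadrants
would cost another factor `k`. The discrepancy is at most `2 t h²`, which is of the order of `k² h⁴`.
-/

/-! ### The Beck–Fiala theorem for real matrices -/

/-- Fewer linear conditions than free coordinates leave a nonzero solution. -/
theorem exists_ne_zero_supported_of_card_lt {ι ρ : Type*} [Fintype ι] [DecidableEq ι]
    (w : ρ → ι → ℝ) (A : Finset ι) (R : Finset ρ) (hcard : R.card < A.card) :
    ∃ y : ι → ℝ, (∃ i, y i ≠ 0) ∧ (∀ i ∉ A, y i = 0) ∧ ∀ r ∈ R, ∑ i, y i * w r i = 0 := by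
  let f : (A → ℝ) →ₗ[ℝ] (R → ℝ) := Matrix.mulVecLin (Matrix.of fun r i => w r.1 i.1)
  have hf : LinearMap.ker f ≠ ⊥ := by
    apply LinearMap.ker_ne_bot_of_finrank_lt
    simpa using hcard
  obtain ⟨z, hz, hz0⟩ := (Submodule.ne_bot_iff _).mp hf
  obtain ⟨i0, hi0⟩ : ∃ i, z i ≠ 0 := by
    by_contra! h
    exact hz0 (funext h)
  refine ⟨fun i => if h : i ∈ A then z ⟨i, h⟩ else 0, ⟨i0, by simpa using hi0⟩,
    fun i hi => by simp [hi], fun r hr => ?_⟩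
  have h1 : f z ⟨r, hr⟩ = 0 := by
    rw [LinearMap.mem_ker.mp hz]; rfl
  have h2 : ∑ i : A, w r i.1 * z i = 0 := h1
  refine Eq.trans ?_ h2
  rw [← Finset.sum_subset (Finset.subset_univ A), ← Finset.sum_coe_sort A]
  · refine Finset.sum_congr rfl fun i _ => ?_
    simp [mul_comm]
  · intro i _ hi
    simp [hi]

/-- Starting from a point of the cube, one can move along a given nonzero direction, which vanishes
at the coordinates that are already extreme, until a further coordinate becomes extreme. -/
theorem exists_step_to_boundary {ι : Type*} [Fintype ι] (x y : ι → ℝ) (hx : ∀ i, |x i| ≤ 1)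
    (hy : ∃ i, y i ≠ 0) (hxy : ∀ i, |x i| = 1 → y i = 0) :
    ∃ c : ℝ, (∀ i, |x i + c * y i| ≤ 1) ∧ ∃ i, |x i| < 1 ∧ |x i + c * y i| = 1 := by
  classical
  obtain ⟨i1, hi1⟩ := hy
  obtain ⟨i0, hi0, hmin⟩ := Finset.exists_min_image (Finset.univ.filter fun i => y i ≠ 0)
    (fun i => (1 - SignType.sign (y i) * x i) / |y i|) ⟨i1, by simpa using hi1⟩
  have hi0' : y i0 ≠ 0 := by simpa using hi0
  have key : ∀ i, y i ≠ 0 → 0 ≤ (1 - SignType.sign (y i) * x i) / |y i| := by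
    intro i hi
    have := abs_le.mp (hx i)
    apply div_nonneg _ (abs_nonneg _)
    rcases lt_or_gt_of_ne hi with h | h
    · simp [sign_neg h]; linarith
    · simp [sign_pos h]; linarith
  set c := (1 - SignType.sign (y i0) * x i0) / |y i0| with hc
  have hc0 : 0 ≤ c := key i0 hi0'
  refine ⟨c, fun i => ?_, i0, lt_of_le_of_ne (hx i0) fun h => hi0' (hxy i0 h), ?_⟩
  · by_cases hi : y i = 0
    · simpa [hi] using hx i
    have h1 : c ≤ (1 - SignType.sign (y i) * x i) / |y i| := hmin i (by simpa using hi)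
    rw [le_div_iff₀ (abs_pos.mpr hi)] at h1
    have h2 := abs_le.mp (hx i)
    rw [abs_le]
    rcases lt_or_gt_of_ne hi with h | h
    · simp only [sign_neg h, abs_of_neg h, SignType.coe_neg_one] at h1
      have := mul_nonneg hc0 (neg_nonneg.mpr h.le)
      constructor <;> linarith
    · simp only [sign_pos h, abs_of_pos h, SignType.coe_one] at h1
      have := mul_nonneg hc0 h.le
      constructor <;> linarith
  · have h1 : c * |y i0| = 1 - SignType.sign (y i0) * x i0 :=
      div_mul_cancel₀ _ (abs_pos.mpr hi0').ne'
    rcases lt_or_gt_of_ne hi0' with h | h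
    · simp only [sign_neg h, abs_of_neg h, SignType.coe_neg_one] at h1
      rw [show x i0 + c * y i0 = -1 by linarith]; simp
    · simp only [sign_pos h, abs_of_pos h, SignType.coe_one] at h1
      rw [show x i0 + c * y i0 = 1 by linarith]; simp

/-- Beck–Fiala with a fractional starting point `x`: if every column of the matrix `w` has
`ℓ¹`-norm at most `t`, the entries of `x` can be rounded to signs so that every row sum changes
by at most `2 t`. -/
theorem exists_signs_of_column_sum_le {ι ρ : Type*} [Fintype ι] [Fintype ρ] (w : ρ → ι → ℝ)
    {t : ℝ} (ht : 0 < t) (hw : ∀ i, ∑ r, |w r i| ≤ t) (x : ι → ℝ) (hx : ∀ i, |x i| ≤ 1) :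
    ∃ χ : ι → ℝ, (∀ i, |χ i| = 1) ∧ (∀ i, |x i| = 1 → χ i = x i) ∧
      ∀ r, |∑ i, (χ i - x i) * w r i| ≤ 2 * t := by
  classical
  induction hm : (Finset.univ.filter fun i => |x i| < 1).card using Nat.strong_induction_on
    generalizing x with
  | _ m ih =>
  set A := Finset.univ.filter fun i => |x i| < 1 with hA
  rcases A.eq_empty_or_nonempty with hAe | hAne
  · refine ⟨x, fun i => ?_, fun _ _ => rfl, fun r => by simp [ht.le]⟩
    have : i ∉ A := by simp [hAe]
    simp only [hA, Finset.mem_filter, Finset.mem_univ, true_and, not_lt] at this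
    exact le_antisymm (hx i) this
  -- Only the rows whose weight on the fractional coordinates exceeds `t` are kept fixed.
  set R := Finset.univ.filter fun r => t < ∑ i ∈ A, |w r i| with hR
  have hcard : R.card < A.card := by
    rcases R.eq_empty_or_nonempty with hRe | hRne
    · rw [hRe]; simpa using hAne.card_pos
    have h1 : (R.card : ℝ) * t < A.card * t := by
      calc (R.card : ℝ) * t = ∑ r ∈ R, t := by simp
        _ < ∑ r ∈ R, ∑ i ∈ A, |w r i| :=
          Finset.sum_lt_sum_of_nonempty hRne fun r hr => by simpa [hR] using hr
        _ = ∑ i ∈ A, ∑ r ∈ R, |w r i| := Finset.sum_comm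
        _ ≤ ∑ i ∈ A, t := Finset.sum_le_sum fun i _ =>
          (Finset.sum_le_univ_sum_of_nonneg fun _ => abs_nonneg _).trans (hw i)
        _ = A.card * t := by simp
    exact_mod_cast lt_of_mul_lt_mul_right h1 ht.le
  obtain ⟨y, hy0, hyA, hyR⟩ := exists_ne_zero_supported_of_card_lt w A R hcard
  have hyx : ∀ i, |x i| = 1 → y i = 0 := fun i hi => hyA i (by simp [hA, hi])
  obtain ⟨c, hc1, i0, hi0, hi0'⟩ := exists_step_to_boundary x y hx hy0 hyx
  have hlt : (Finset.univ.filter fun i => |x i + c * y i| < 1).card < m := by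
    rw [← hm]
    apply Finset.card_lt_card
    refine ⟨fun i hi => ?_, fun h => ?_⟩
    · simp only [Finset.mem_filter, Finset.mem_univ, true_and] at hi
      by_contra h
      rw [hyA i h] at hi
      simp [hA] at h
      simp at hi
      linarith
    · have := h (show i0 ∈ A by simp [hA, hi0])
      simp [hi0'] at this
  obtain ⟨χ, hχ1, hχx, hχ⟩ := ih _ hlt (fun i => x i + c * y i) hc1 rfl
  have hfix : ∀ i, |x i| = 1 → χ i = x i := fun i hi => by
    have := hχx i (by simp [hyx i hi, hi])
    simpa [hyx i hi] using this
  refine ⟨χ, hχ1, hfix, fun r => ?_⟩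
  by_cases hr : r ∈ R
  · have h1 : ∑ i, (χ i - x i) * w r i
        = ∑ i, (χ i - (x i + c * y i)) * w r i + c * ∑ i, y i * w r i := by
      rw [Finset.mul_sum, ← Finset.sum_add_distrib]
      exact Finset.sum_congr rfl fun i _ => by ring
    rw [h1, hyR r hr, mul_zero, add_zero]
    exact hχ r
  · -- From now on this row can change by at most twice its remaining weight.
    have hr' : ∑ i ∈ A, |w r i| ≤ t := by simpa [hR] using hr
    have h1 : ∑ i, (χ i - x i) * w r i = ∑ i ∈ A, (χ i - x i) * w r i := by
      symm
      apply Finset.sum_subset (Finset.subset_univ A)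
      intro i _ hi
      have : |x i| = 1 := le_antisymm (hx i) (by simpa [hA] using hi)
      simp [hfix i this]
    rw [h1]
    calc |∑ i ∈ A, (χ i - x i) * w r i| ≤ ∑ i ∈ A, |(χ i - x i) * w r i| :=
          Finset.abs_sum_le_sum_abs _ _
      _ ≤ ∑ i ∈ A, 2 * |w r i| := Finset.sum_le_sum fun i _ => by
          rw [abs_mul]
          apply mul_le_mul_of_nonneg_right _ (abs_nonneg _)
          have := abs_sub (χ i) (x i)
          linarith [hχ1 i, hx i]
      _ = 2 * ∑ i ∈ A, |w r i| := by rw [Finset.mul_sum]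
      _ ≤ 2 * t := by linarith

/-- The Beck–Fiala theorem for real matrices. -/
theorem beck_fiala {ι ρ : Type*} [Fintype ι] [Fintype ρ] (w : ρ → ι → ℝ)
    {t : ℝ} (ht : 0 < t) (hw : ∀ i, ∑ r, |w r i| ≤ t) :
    ∃ χ : ι → ℝ, (∀ i, |χ i| = 1) ∧ ∀ r, |∑ i, χ i * w r i| ≤ 2 * t := by
  obtain ⟨χ, h1, -, h2⟩ := exists_signs_of_column_sum_le w ht hw (fun _ => 0) (by simp)
  exact ⟨χ, h1, by simpa using h2⟩

/-! ### Dyadic decomposition of two-parameter threshold functions -/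

/-- The largest multiple of `2 ^ e` that is at most `u`. -/
def dyadicFloor (e u : ℕ) : ℕ := u / 2 ^ e * 2 ^ e

theorem dyadicFloor_zero (u : ℕ) : dyadicFloor 0 u = u := by simp [dyadicFloor]

theorem dyadicFloor_eq_zero {e u : ℕ} (h : u < 2 ^ e) : dyadicFloor e u = 0 := by
  simp [dyadicFloor, Nat.div_eq_of_lt h]

theorem sub_eq_sum_dyadicFloor (f : ℕ → ℝ) {h u : ℕ} (hu : u < 2 ^ h) :
    f u - f 0 = ∑ e : Fin h, (f (dyadicFloor e u) - f (dyadicFloor (e + 1) u)) := by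
  rw [Fin.sum_univ_eq_sum_range fun e => f (dyadicFloor e u) - f (dyadicFloor (e + 1) u),
    Finset.sum_range_sub', dyadicFloor_zero, dyadicFloor_eq_zero hu]

/-- A name `(e, c)` for a dyadic block below `2 ^ h`: the interval `[lo, hi)` from the largest
multiple of `2 ^ (e + 1)` to the largest multiple of `2 ^ e` that is at most `u`, for any `u` with
`u / 2 ^ e = c`. It is empty for even
`c` and has length `2 ^ e` for odd `c`. -/
abbrev DyadicBlock (h : ℕ) : Type := Fin h × Fin (2 ^ h)

/-- The left end of a dyadic block. -/
def DyadicBlock.lo {h : ℕ} (b : DyadicBlock h) : ℕ := (b.2 : ℕ) / 2 * 2 ^ ((b.1 : ℕ) + 1)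

/-- The right end of a dyadic block, which does not belong to it. -/
def DyadicBlock.hi {h : ℕ} (b : DyadicBlock h) : ℕ := (b.2 : ℕ) * 2 ^ (b.1 : ℕ)

theorem DyadicBlock.lo_le_hi {h : ℕ} (b : DyadicBlock h) : b.lo ≤ b.hi := by
  unfold DyadicBlock.lo DyadicBlock.hi
  rw [pow_succ', ← mul_assoc]
  exact Nat.mul_le_mul_right _ (Nat.div_mul_le_self _ _)

/-- The block of scale `e` that the dyadic expansion of `u` uses. -/
def dyadicBlockOf {h u : ℕ} (hu : u < 2 ^ h) (e : Fin h) : DyadicBlock h :=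
  (e, ⟨u / 2 ^ (e : ℕ), (Nat.div_le_self _ _).trans_lt hu⟩)

theorem dyadicBlockOf_hi {h u : ℕ} (hu : u < 2 ^ h) (e : Fin h) :
    (dyadicBlockOf hu e).hi = dyadicFloor e u := rfl

theorem dyadicBlockOf_lo {h u : ℕ} (hu : u < 2 ^ h) (e : Fin h) :
    (dyadicBlockOf hu e).lo = dyadicFloor (e + 1) u := by
  simp only [DyadicBlock.lo, dyadicBlockOf, dyadicFloor, Nat.div_div_eq_div_mul, pow_succ]

/-- At each scale, a number lies in at most one block. -/
theorem card_dyadicBlock_mem_le {h : ℕ} (a : ℕ) :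
    (Finset.univ.filter fun b : DyadicBlock h => b.lo ≤ a ∧ a < b.hi).card ≤ h := by
  calc _ ≤ (Finset.univ : Finset (Fin h)).card := by
        apply Finset.card_le_card_of_injOn Prod.fst (fun _ _ => by simp)
        have key : ∀ b : DyadicBlock h, b.lo ≤ a → a < b.hi → (b.2 : ℕ) = a / 2 ^ (b.1 : ℕ) + 1 := by
          intro b h1 h2
          have hpos : 0 < 2 ^ (b.1 : ℕ) := by positivity
          have h3 : a / 2 ^ (b.1 : ℕ) < b.2 := (Nat.div_lt_iff_lt_mul hpos).mpr h2
          have h4 : (b.2 : ℕ) / 2 * 2 ≤ a / 2 ^ (b.1 : ℕ) := by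
            rw [Nat.le_div_iff_mul_le hpos, mul_assoc, ← pow_succ']
            exact h1
          omega
        intro b hb b' hb' hbb
        simp only [Finset.coe_filter, Finset.mem_univ, true_and, Set.mem_ofPred_eq] at hb hb'
        refine Prod.ext hbb (Fin.ext ?_)
        rw [key b hb.1 hb.2, key b' hb'.1 hb'.2, hbb]
    _ = h := by simp

/-- The mixed second difference of `F` over a rectangle of dyadic blocks. -/
def mixedDiff (F : ℕ → ℕ → ℝ) {h : ℕ} (b b' : DyadicBlock h) : ℝ :=
  (F b.hi b'.hi - F b.lo b'.hi) - (F b.hi b'.lo - F b.lo b'.lo)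

theorem eq_sum_mixedDiff (F : ℕ → ℕ → ℝ) (h0 : ∀ v, F 0 v = 0) (h0' : ∀ u, F u 0 = 0) {h u v : ℕ}
    (hu : u < 2 ^ h) (hv : v < 2 ^ h) :
    F u v = ∑ e : Fin h, ∑ e' : Fin h, mixedDiff F (dyadicBlockOf hu e) (dyadicBlockOf hv e') := by
  have h1 := sub_eq_sum_dyadicFloor (fun u => F u v) hu
  simp only [h0, sub_zero] at h1
  rw [h1]
  refine Finset.sum_congr rfl fun e _ => ?_
  have h2 := sub_eq_sum_dyadicFloor
    (fun v => F (dyadicFloor e u) v - F (dyadicFloor (e + 1) u) v) hv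
  simp only [h0', sub_zero] at h2
  rw [h2]
  simp only [mixedDiff, dyadicBlockOf_hi, dyadicBlockOf_lo]

/-- The number of the points `(α l, β l)` that are dominated by `(u, v)`. -/
def dominatedCount {k : ℕ} (α β : Fin k → ℕ) (u v : ℕ) : ℕ :=
  (Finset.univ.filter fun l => α l < u ∧ β l < v).card

/-- The indicator of the staircase region of all `(u, v)` that dominate more than `j` of the points
`(α l, β l)`. -/
noncomputable def staircase {k : ℕ} (α β : Fin k → ℕ) (j u v : ℕ) : ℝ :=
  if j < dominatedCount α β u v then 1 else 0

theorem sum_abs_threshold_sub_le (k : ℕ) {p q : ℕ} (hpq : p ≤ q) :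
    ∑ j : Fin k, |(if (j : ℕ) < q then 1 else 0 : ℝ) - (if (j : ℕ) < p then 1 else 0)|
      ≤ ((q - p : ℕ) : ℝ) := by
  have h1 : ∀ j : Fin k, |(if (j : ℕ) < q then 1 else 0 : ℝ) - (if (j : ℕ) < p then 1 else 0)|
      = if p ≤ (j : ℕ) ∧ (j : ℕ) < q then 1 else 0 := by
    intro j
    split_ifs <;> first | (simp; done) | (exfalso; omega)
  simp only [h1]
  rw [Finset.sum_boole, Nat.cast_le, ← Nat.card_Ico p q]
  apply Finset.card_le_card_of_injOn (fun j : Fin k => (j : ℕ))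
  · intro j hj
    simpa using hj
  · exact fun _ _ _ _ h => Fin.ext h

theorem dominatedCount_comm {k : ℕ} (α β : Fin k → ℕ) (u v : ℕ) :
    dominatedCount α β u v = dominatedCount β α v u := by
  simp only [dominatedCount, and_comm]

theorem staircase_comm {k : ℕ} (α β : Fin k → ℕ) (j u v : ℕ) :
    staircase α β j u v = staircase β α j v u := by
  simp only [staircase, dominatedCount_comm α β]

/-- The number of the values `α l` in a dyadic block. -/
def blockCount {k : ℕ} (α : Fin k → ℕ) {h : ℕ} (b : DyadicBlock h) : ℕ :=
  (Finset.univ.filter fun l => b.lo ≤ α l ∧ α l < b.hi).card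

theorem sum_abs_staircase_sub_le {k : ℕ} (α β : Fin k → ℕ) {h : ℕ} (b : DyadicBlock h) (v : ℕ) :
    ∑ j : Fin k, |staircase α β j b.hi v - staircase α β j b.lo v| ≤ (blockCount α b : ℝ) := by
  have hle := b.lo_le_hi
  refine (sum_abs_threshold_sub_le k (p := dominatedCount α β b.lo v)
    (q := dominatedCount α β b.hi v) ?_).trans ?_
  · exact Finset.card_le_card fun l hl => by
      simp only [Finset.mem_filter, Finset.mem_univ, true_and] at hl ⊢
      omega
  · rw [Nat.cast_le, tsub_le_iff_left]
    refine (Finset.card_le_card fun l hl => ?_).trans (Finset.card_union_le _ _)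
    simp only [Finset.mem_union, Finset.mem_filter, Finset.mem_univ, true_and] at hl ⊢
    omega

theorem sum_abs_mixedDiff_staircase_le_left {k : ℕ} (α β : Fin k → ℕ) {h : ℕ}
    (b b' : DyadicBlock h) :
    ∑ j : Fin k, |mixedDiff (staircase α β j) b b'| ≤ 2 * (blockCount α b : ℝ) := by
  calc _ ≤ ∑ j : Fin k, (|staircase α β j b.hi b'.hi - staircase α β j b.lo b'.hi|
          + |staircase α β j b.hi b'.lo - staircase α β j b.lo b'.lo|) :=
        Finset.sum_le_sum fun j _ => abs_sub _ _
    _ ≤ _ := by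
        rw [Finset.sum_add_distrib, two_mul]
        exact add_le_add (sum_abs_staircase_sub_le α β b _) (sum_abs_staircase_sub_le α β b _)

theorem mixedDiff_staircase_comm {k : ℕ} (α β : Fin k → ℕ) (j : ℕ) {h : ℕ}
    (b b' : DyadicBlock h) :
    mixedDiff (staircase α β j) b b' = mixedDiff (staircase β α j) b' b := by
  simp only [mixedDiff, staircase_comm α β]
  ring

/-- Over all thresholds together, the staircases jump at most `2 min (A, B)` times across a
rectangle whose sides contain `A` of the `α l` and `B` of the `β l`. -/
theorem sum_abs_mixedDiff_staircase_le {k : ℕ} (α β : Fin k → ℕ) {h : ℕ}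
    (b b' : DyadicBlock h) :
    ∑ j : Fin k, |mixedDiff (staircase α β j) b b'|
      ≤ 2 * ((blockCount α b : ℝ) * (blockCount β b' : ℝ)) := by
  have h1 := sum_abs_mixedDiff_staircase_le_left α β b b'
  have h2 := sum_abs_mixedDiff_staircase_le_left β α b' b
  simp only [← mixedDiff_staircase_comm α β] at h2
  rcases Nat.eq_zero_or_pos (blockCount β b') with hB | hB
  · simpa [hB] using h2
  · have h3 : (1 : ℝ) ≤ blockCount β b' := by exact_mod_cast hB
    have h4 : (0 : ℝ) ≤ blockCount α b := by positivity
    nlinarith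

theorem sum_blockCount_le {k : ℕ} (α : Fin k → ℕ) (h : ℕ) :
    ∑ b : DyadicBlock h, blockCount α b ≤ k * h := by
  simp only [blockCount, Finset.card_filter]
  rw [Finset.sum_comm]
  simp only [← Finset.card_filter]
  calc _ ≤ ∑ _l : Fin k, h := Finset.sum_le_sum fun l _ => card_dyadicBlock_mem_le (α l)
    _ = k * h := by simp

/-- The total `ℓ¹`-weight of all mixed differences of the staircases of one uncertain point. -/
theorem sum_sum_abs_mixedDiff_staircase_le {k : ℕ} (α β : Fin k → ℕ) (h : ℕ) :
    ∑ r : (DyadicBlock h × DyadicBlock h) × Fin k,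
      |mixedDiff (staircase α β r.2) r.1.1 r.1.2| ≤ 2 * ((k : ℝ) * h) ^ 2 := by
  rw [Fintype.sum_prod_type, Fintype.sum_prod_type]
  calc _ ≤ ∑ b : DyadicBlock h, ∑ b' : DyadicBlock h,
          2 * ((blockCount α b : ℝ) * (blockCount β b' : ℝ)) :=
        Finset.sum_le_sum fun b _ => Finset.sum_le_sum fun b' _ =>
          sum_abs_mixedDiff_staircase_le α β b b'
    _ = 2 * (((∑ b : DyadicBlock h, blockCount α b : ℕ) : ℝ)
          * ((∑ b' : DyadicBlock h, blockCount β b' : ℕ) : ℝ)) := by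
        push_cast
        rw [Finset.sum_mul_sum]
        simp only [Finset.mul_sum]
    _ ≤ 2 * (((k * h : ℕ) : ℝ) * ((k * h : ℕ) : ℝ)) := by
        have h1 : ((∑ b : DyadicBlock h, blockCount α b : ℕ) : ℝ) ≤ (k * h : ℕ) :=
          Nat.cast_le.mpr (sum_blockCount_le α h)
        have h2 : ((∑ b : DyadicBlock h, blockCount β b : ℕ) : ℝ) ≤ (k * h : ℕ) :=
          Nat.cast_le.mpr (sum_blockCount_le β h)
        gcongr
    _ = _ := by push_cast; ring

/-- A low-discrepancy colouring for staircase ranges. -/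
theorem exists_signs_staircase {ι : Type*} [Fintype ι] {k h : ℕ} (hk : 1 ≤ k) (hh : 1 ≤ h)
    (T : Finset ι) (α β : ι → Fin k → ℕ) :
    ∃ χ : ι → ℝ, (∀ i, |χ i| = 1) ∧ |∑ i ∈ T, χ i| ≤ 6 * (k : ℝ) ^ 2 * (h : ℝ) ^ 4 ∧
      ∀ j < k, ∀ u < 2 ^ h, ∀ v < 2 ^ h,
        |∑ i ∈ T, χ i * staircase (α i) (β i) j u v| ≤ 6 * (k : ℝ) ^ 2 * (h : ℝ) ^ 4 := by
  classical
  have hk' : (1 : ℝ) ≤ k := by exact_mod_cast hk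
  have hh' : (1 : ℝ) ≤ h := by exact_mod_cast hh
  have hkh : (1 : ℝ) ≤ ((k : ℝ) * h) ^ 2 := one_le_pow₀ (by nlinarith)
  -- The rows: all mixed differences, and one more row for the number of points.
  let w : Option ((DyadicBlock h × DyadicBlock h) × Fin k) → ι → ℝ := fun r i =>
    if i ∈ T then r.elim 1 fun r => mixedDiff (staircase (α i) (β i) r.2) r.1.1 r.1.2 else 0
  obtain ⟨χ, hχ, hrow⟩ := beck_fiala w (t := 3 * ((k : ℝ) * h) ^ 2) (by positivity) fun i => by
    by_cases hi : i ∈ T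
    · simp only [w, hi, if_true, Fintype.sum_option, Option.elim, abs_one]
      linarith [sum_sum_abs_mixedDiff_staircase_le (α i) (β i) h]
    · simp only [w, hi, if_false, abs_zero, Finset.sum_const_zero]
      positivity
  have hw : ∀ r, ∑ i, χ i * w r i = ∑ i ∈ T, χ i * r.elim 1 fun r =>
      mixedDiff (staircase (α i) (β i) r.2) r.1.1 r.1.2 := by
    intro r
    simp only [w, mul_ite, mul_zero, Finset.sum_ite_mem, Finset.univ_inter]
  refine ⟨χ, hχ, ?_, fun j hj u hu v hv => ?_⟩
  · have h1 := hrow none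
    rw [hw] at h1
    simp only [Option.elim, mul_one] at h1
    have h2 : (1 : ℝ) ≤ (h : ℝ) ^ 2 := one_le_pow₀ hh'
    calc _ ≤ _ := h1
      _ = 6 * (k : ℝ) ^ 2 * (h : ℝ) ^ 2 * 1 := by ring
      _ ≤ 6 * (k : ℝ) ^ 2 * (h : ℝ) ^ 2 * (h : ℝ) ^ 2 := by gcongr
      _ = _ := by ring
  · have h0 : ∀ i v, staircase (α i) (β i) j 0 v = 0 := by simp [staircase, dominatedCount]
    have h0' : ∀ i u, staircase (α i) (β i) j u 0 = 0 := by simp [staircase, dominatedCount]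
    have h1 : ∑ i ∈ T, χ i * staircase (α i) (β i) j u v
        = ∑ e : Fin h, ∑ e' : Fin h, ∑ i ∈ T, χ i *
          mixedDiff (staircase (α i) (β i) j) (dyadicBlockOf hu e) (dyadicBlockOf hv e') := by
      simp only [fun i => eq_sum_mixedDiff (staircase (α i) (β i) j) (h0 i) (h0' i) hu hv,
        Finset.mul_sum]
      rw [Finset.sum_comm]
      exact Finset.sum_congr rfl fun e _ => Finset.sum_comm
    rw [h1]
    calc _ ≤ ∑ e : Fin h, ∑ e' : Fin h, |∑ i ∈ T, χ i *
          mixedDiff (staircase (α i) (β i) j) (dyadicBlockOf hu e) (dyadicBlockOf hv e')| :=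
          (Finset.abs_sum_le_sum_abs _ _).trans
            (Finset.sum_le_sum fun e _ => Finset.abs_sum_le_sum_abs _ _)
      _ ≤ ∑ _e : Fin h, ∑ _e' : Fin h, 2 * (3 * ((k : ℝ) * h) ^ 2) := by
          refine Finset.sum_le_sum fun e _ => Finset.sum_le_sum fun e' _ => ?_
          have := hrow (some ((dyadicBlockOf hu e, dyadicBlockOf hv e'), ⟨j, hj⟩))
          rwa [hw] at this
      _ = _ := by simp; ring

/-! ### Repeated halving of a family of uncertain points -/

/-- The number of locations of an uncertain point in the interval `[a, b]`. -/
noncomputable def UncertainPoint.countIcc {k : ℕ} (p : UncertainPoint k) (a b : ℝ) : ℕ :=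
  (Finset.univ.filter fun l => a ≤ p.loc l ∧ p.loc l ≤ b).card

theorem UncertainPoint.countIcc_le {k : ℕ} (p : UncertainPoint k) (a b : ℝ) :
    p.countIcc a b ≤ k := by
  simpa [UncertainPoint.countIcc] using
    Finset.card_filter_le (Finset.univ : Finset (Fin k)) fun l => a ≤ p.loc l ∧ p.loc l ≤ b

/-- The points of the subfamily `T` with more than `j` locations in `[a, b]`. -/
noncomputable def heavy {ι : Type*} {k : ℕ} (P : ι → UncertainPoint k) (T : Finset ι) (a b : ℝ)
    (j : ℕ) : Finset ι :=
  T.filter fun i => j < (P i).countIcc a b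

/-- A real threshold can be replaced by a threshold for ranks within a finite set. -/
theorem le_iff_card_filter_lt {γ δ : Type*} [LinearOrder δ] (S : Finset γ) (f : γ → δ) (a : δ)
    {x : γ} (hx : x ∈ S) :
    a ≤ f x ↔ (S.filter fun y => f x < f y).card < (S.filter fun y => a ≤ f y).card := by
  constructor
  · intro h
    apply Finset.card_lt_card
    refine ⟨fun y hy => ?_, fun hsub => ?_⟩
    · rw [Finset.mem_filter] at hy ⊢
      exact ⟨hy.1, h.trans hy.2.le⟩
    · have := hsub (Finset.mem_filter.mpr ⟨hx, h⟩)
      simp at this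
  · intro h
    by_contra! hlt
    refine absurd (Finset.card_le_card fun y hy => ?_) (not_le.mpr h)
    rw [Finset.mem_filter] at hy ⊢
    exact ⟨hy.1, hlt.trans_le hy.2⟩

/-- A low-discrepancy colouring for the sets of heavy points. A location is replaced by the number of
locations to its right and the number of those to its left. -/
theorem exists_signs_heavy {ι : Type*} [Fintype ι] {k h : ℕ} (hk : 1 ≤ k) (hh : 1 ≤ h)
    (P : ι → UncertainPoint k) (T : Finset ι) (hT : T.card * k < 2 ^ h) :
    ∃ χ : ι → ℝ, (∀ i, |χ i| = 1) ∧ |∑ i ∈ T, χ i| ≤ 6 * (k : ℝ) ^ 2 * (h : ℝ) ^ 4 ∧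
      ∀ j < k, ∀ a b : ℝ, |∑ i ∈ heavy P T a b j, χ i| ≤ 6 * (k : ℝ) ^ 2 * (h : ℝ) ^ 4 := by
  let S : Finset (ι × Fin k) := T ×ˢ Finset.univ
  have hS : S.card < 2 ^ h := by simpa [S] using hT
  let f : ι × Fin k → ℝ := fun y => (P y.1).loc y.2
  obtain ⟨χ, h1, h2, h3⟩ := exists_signs_staircase hk hh T
    (fun i l => (S.filter fun y => f (i, l) < f y).card)
    (fun i l => (S.filter fun y => f y < f (i, l)).card)
  refine ⟨χ, h1, h2, fun j hj a b => ?_⟩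
  have h4 := h3 j hj (S.filter fun y => a ≤ f y).card ((Finset.card_filter_le _ _).trans_lt hS)
    (S.filter fun y => f y ≤ b).card ((Finset.card_filter_le _ _).trans_lt hS)
  convert h4 using 2
  rw [heavy, Finset.sum_filter]
  refine Finset.sum_congr rfl fun i hi => ?_
  rw [staircase, mul_ite, mul_one, mul_zero]
  congr 2
  simp only [UncertainPoint.countIcc, dominatedCount]
  congr 2
  ext l
  -- The order of the line is reversed for the right end of the interval.
  have hx : (i, l) ∈ S := by simp [S, hi]
  exact and_congr (le_iff_card_filter_lt S f a hx)
    (le_iff_card_filter_lt (δ := ℝᵒᵈ) S f b hx)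

/-- For a signing `χ`, twice the size of the positive class differs from the size of the whole set
by the sum of the signs. -/
theorem two_mul_card_filter_eq_one_sub {ι : Type*} (χ : ι → ℝ) (hχ : ∀ i, |χ i| = 1)
    (S : Finset ι) :
    2 * ((S.filter fun i => χ i = 1).card : ℝ) - S.card = ∑ i ∈ S, χ i := by
  rw [Finset.card_filter, Finset.card_eq_sum_ones, Nat.cast_sum, Nat.cast_sum, Finset.mul_sum,
    ← Finset.sum_sub_distrib]
  refine Finset.sum_congr rfl fun i _ => ?_
  rcases (abs_eq zero_le_one).mp (hχ i) with h | h <;> norm_num [h]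

theorem heavy_filter {ι : Type*} {k : ℕ} (P : ι → UncertainPoint k) (T : Finset ι) (a b : ℝ)
    (j : ℕ) (p : ι → Prop) [DecidablePred p] :
    heavy P (T.filter p) a b j = (heavy P T a b j).filter p := by
  simp only [heavy, Finset.filter_filter, and_comm]

/-- Keeping the smaller class of a low-discrepancy colouring roughly halves all sets of heavy points. -/
theorem exists_halving {ι : Type*} [Fintype ι] {k h : ℕ} (hk : 1 ≤ k) (hh : 1 ≤ h)
    (P : ι → UncertainPoint k) (T : Finset ι) (hT : T.card * k < 2 ^ h) :
    ∃ T' : Finset ι, 2 * T'.card ≤ T.card ∧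
      |2 * (T'.card : ℝ) - T.card| ≤ 6 * (k : ℝ) ^ 2 * (h : ℝ) ^ 4 ∧
      ∀ j < k, ∀ a b : ℝ, |2 * ((heavy P T' a b j).card : ℝ) - (heavy P T a b j).card|
        ≤ 6 * (k : ℝ) ^ 2 * (h : ℝ) ^ 4 := by
  classical
  obtain ⟨χ, h1, h2, h3, h4⟩ : ∃ χ : ι → ℝ, (∀ i, |χ i| = 1) ∧
      |∑ i ∈ T, χ i| ≤ 6 * (k : ℝ) ^ 2 * (h : ℝ) ^ 4 ∧
      (∀ j < k, ∀ a b : ℝ, |∑ i ∈ heavy P T a b j, χ i| ≤ 6 * (k : ℝ) ^ 2 * (h : ℝ) ^ 4) ∧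
      ∑ i ∈ T, χ i ≤ 0 := by
    -- Negating all the signs if necessary makes the positive class the smaller one.
    obtain ⟨χ, h1, h2, h3⟩ := exists_signs_heavy hk hh P T hT
    rcases le_total (∑ i ∈ T, χ i) 0 with h | h
    · exact ⟨χ, h1, h2, h3, h⟩
    · exact ⟨fun i => -χ i, by simpa using h1, by simpa using h2, by simpa using h3,
        by simpa using h⟩
  have h5 := two_mul_card_filter_eq_one_sub χ h1 T
  refine ⟨T.filter fun i => χ i = 1, ?_, ?_, fun j hj a b => ?_⟩
  · have : 2 * ((T.filter fun i => χ i = 1).card : ℝ) ≤ T.card := by linarith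
    exact_mod_cast this
  · rwa [h5]
  · rw [heavy_filter, two_mul_card_filter_eq_one_sub χ h1]
    exact h3 j hj a b

/-- The inductive step of the error bound `36 k² x⁴`: the error carried over, `36 k² (x + 1) ^ 4`, and
the new one, `6 k² (x + 1) ^ 4`, together are at most twice the bound. The factor two is the growth of
the weight of a point. The inequality needs `7 ≤ x`, which the summand `8` in the value
`x = s + log₂ k + 8` used below ensures. -/
theorem halving_error_step {x : ℝ} (hx : 7 ≤ x) : 42 * (x + 1) ^ 4 ≤ 72 * x ^ 4 := by
  have h1 : (x + 1) ^ 4 ≤ (8 / 7 * x) ^ 4 := by gcongr; linarith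
  have h2 : 0 ≤ x ^ 4 := by positivity
  rw [mul_pow] at h1
  norm_num at h1
  linarith

theorem abs_two_pow_succ_mul_sub_le {d : ℕ} {m t t' D E : ℝ} (h1 : |2 ^ d * t - m| ≤ E)
    (h2 : |2 * t' - t| ≤ D) : |2 ^ (d + 1) * t' - m| ≤ 2 ^ d * D + E := by
  have h3 : (2 : ℝ) ^ (d + 1) * t' - m = 2 ^ d * (2 * t' - t) + (2 ^ d * t - m) := by ring
  rw [h3]
  refine (abs_add_le _ _).trans (add_le_add ?_ h1)
  rw [abs_mul, abs_of_pos (by positivity : (0 : ℝ) < 2 ^ d)]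
  gcongr

/-- After `d` halvings at most `2 ^ s` points remain. Each of them stands for `2 ^ d` points, up
to an error that does not depend on the size of the initial family, apart from the scaling. -/
theorem exists_iterated_halving {ι : Type*} [Fintype ι] {k : ℕ} (hk : 1 ≤ k)
    (P : ι → UncertainPoint k) (d s : ℕ) (hn : Fintype.card ι ≤ 2 ^ (s + d)) :
    ∃ T : Finset ι, T.card ≤ 2 ^ s ∧
      |2 ^ d * (T.card : ℝ) - Fintype.card ι|
        ≤ 2 ^ d * (36 * (k : ℝ) ^ 2 * (s + Nat.log 2 k + 8 : ℝ) ^ 4) ∧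
      ∀ j < k, ∀ a b : ℝ,
        |2 ^ d * ((heavy P T a b j).card : ℝ) - (heavy P Finset.univ a b j).card|
        ≤ 2 ^ d * (36 * (k : ℝ) ^ 2 * (s + Nat.log 2 k + 8 : ℝ) ^ 4) := by
  induction d generalizing s with
  | zero => exact ⟨Finset.univ, by simpa using hn, by simp; positivity, by
      intro j hj a b; simp; positivity⟩
  | succ d ih =>
    obtain ⟨T, hT, hall, hheavy⟩ := ih (s + 1) (by rwa [add_assoc, add_comm 1 d])
    have hTk : T.card * k < 2 ^ (s + 1 + (Nat.log 2 k + 1)) := by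
      rw [pow_add]
      exact Nat.mul_lt_mul_of_le_of_lt hT (Nat.lt_pow_succ_log_self one_lt_two k)
        (by positivity)
    obtain ⟨T', hT', hall', hheavy'⟩ := exists_halving hk (by omega) P T hTk
    have herr : 2 ^ d * (6 * (k : ℝ) ^ 2 * ((s + 1 + (Nat.log 2 k + 1) : ℕ) : ℝ) ^ 4)
        + 2 ^ d * (36 * (k : ℝ) ^ 2 * ((s + 1 : ℕ) + Nat.log 2 k + 8 : ℝ) ^ 4)
        ≤ 2 ^ (d + 1) * (36 * (k : ℝ) ^ 2 * (s + Nat.log 2 k + 8 : ℝ) ^ 4) := by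
      set x : ℝ := s + Nat.log 2 k + 8 with hx
      have h7 : 7 ≤ x := by
        have : (0 : ℝ) ≤ s + Nat.log 2 k := by positivity
        linarith
      have h1 : ((s + 1 + (Nat.log 2 k + 1) : ℕ) : ℝ) ≤ x + 1 := by push_cast; linarith
      have h2 : ((s + 1 : ℕ) + Nat.log 2 k + 8 : ℝ) = x + 1 := by push_cast; linarith
      rw [h2]
      calc _ ≤ 2 ^ d * (6 * (k : ℝ) ^ 2 * (x + 1) ^ 4)
            + 2 ^ d * (36 * (k : ℝ) ^ 2 * (x + 1) ^ 4) := by gcongr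
        _ = 2 ^ d * (k : ℝ) ^ 2 * (42 * (x + 1) ^ 4) := by ring
        _ ≤ 2 ^ d * (k : ℝ) ^ 2 * (72 * x ^ 4) :=
          mul_le_mul_of_nonneg_left (halving_error_step h7) (by positivity)
        _ = _ := by ring
    refine ⟨T', ?_, ?_, fun j hj a b => ?_⟩
    · rw [pow_succ] at hT; omega
    · exact (abs_two_pow_succ_mul_sub_le hall hall').trans herr
    · exact (abs_two_pow_succ_mul_sub_le (hheavy j hj a b) (hheavy' j hj a b)).trans herr

/-- Normalising an approximation of the size of a set and of a subset. -/
theorem abs_div_sub_div_le {N n m t s E : ℝ} (hn : 0 < n) (ht : 0 < t) (hs : 0 ≤ s)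
    (hst : s ≤ t) (h1 : |N * t - n| ≤ E) (h2 : |N * s - m| ≤ E) :
    |m / n - s / t| ≤ 2 * E / n := by
  have h3 : m / n - s / t = -(N * s - m) / n + s / t * ((N * t - n) / n) := by
    field_simp; ring
  have h4 : |s / t| ≤ 1 := by
    rw [abs_of_nonneg (by positivity)]
    exact div_le_one_of_le₀ hst ht.le
  rw [h3]
  calc _ ≤ |-(N * s - m) / n| + |s / t * ((N * t - n) / n)| := abs_add_le _ _
    _ = |N * s - m| / n + |s / t| * (|N * t - n| / n) := by
      rw [abs_div, abs_neg, abs_mul, abs_div (N * t - n), abs_of_pos hn]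
    _ ≤ E / n + 1 * (E / n) := by gcongr
    _ = _ := by ring

/-! ### Probabilities as location counts -/

theorem law_isProbabilityMeasure {k : ℕ} (hk : 1 ≤ k) (p : UncertainPoint k) :
    IsProbabilityMeasure p.law := by
  have : Nonempty (Fin k) := ⟨⟨0, hk⟩⟩
  have : IsProbabilityMeasure (ProbabilityTheory.uniformOn (Set.univ : Set (Fin k))) :=
    ProbabilityTheory.isProbabilityMeasure_uniformOn Set.finite_univ Set.univ_nonempty
  exact Measure.isProbabilityMeasure_map (measurable_of_finite _).aemeasurable

theorem law_real_Icc {k : ℕ} (p : UncertainPoint k) (a b : ℝ) :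
    p.law.real (Set.Icc a b) = (p.countIcc a b : ℝ) / k := by
  have h1 : p.loc ⁻¹' Set.Icc a b
      = ↑(Finset.univ.filter fun l => a ≤ p.loc l ∧ p.loc l ≤ b) := by
    ext l; simp
  rw [measureReal_def, UncertainPoint.law, Measure.map_apply (measurable_of_finite _)
    measurableSet_Icc, ProbabilityTheory.uniformOn_univ, h1, Measure.count_apply_finset,
    ENNReal.toReal_div]
  simp [UncertainPoint.countIcc]

theorem transversalLaw_real_Icc {ι : Type} [Fintype ι] {k : ℕ} (hk : 1 ≤ k)
    (P : ι → UncertainPoint k) (i : ι) (a b : ℝ) :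
    (transversalLaw P).real {Q : ι → ℝ | Q i ∈ Set.Icc a b} = ((P i).countIcc a b : ℝ) / k := by
  have := fun i => law_isProbabilityMeasure hk (P i)
  rw [← law_real_Icc, transversalLaw]
  exact (measurePreserving_eval (fun i => (P i).law) i).measureReal_preimage
    measurableSet_Icc.nullMeasurableSet

theorem rcFraction_subfamily_Icc {ι : Type} [Fintype ι] {k : ℕ} (hk : 1 ≤ k)
    (P : ι → UncertainPoint k) (T : Finset ι) (a b τ : ℝ) :
    rcFraction (fun i : T => P i) (Set.Icc a b) τ
      = ((T.filter fun i => ⌈τ * k⌉₊ ≤ (P i).countIcc a b).card : ℝ) / T.card := by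
  have hk' : (0 : ℝ) < k := by exact_mod_cast hk
  rw [rcFraction, Fintype.card_coe]
  simp only [transversalLaw_real_Icc hk, le_div_iff₀ hk', ← Nat.ceil_le]
  congr 2
  rw [Nat.card_eq_fintype_card, Fintype.card_subtype,
    ← Finset.card_map (Function.Embedding.subtype _)]
  congr 1
  ext i
  simp [and_comm]

theorem rcFraction_Icc {ι : Type} [Fintype ι] {k : ℕ} (hk : 1 ≤ k)
    (P : ι → UncertainPoint k) (a b τ : ℝ) :
    rcFraction P (Set.Icc a b) τ
      = ((Finset.univ.filter fun i => ⌈τ * k⌉₊ ≤ (P i).countIcc a b).card : ℝ)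
        / Fintype.card ι := by
  have hk' : (0 : ℝ) < k := by exact_mod_cast hk
  rw [rcFraction]
  simp only [transversalLaw_real_Icc hk, le_div_iff₀ hk', ← Nat.ceil_le]
  rw [Nat.card_eq_fintype_card, Fintype.card_subtype]

/-- Thresholds `τ ≤ 1` correspond to the location counts `0, …, k`, and the count `0` is trivial:
it suffices to control the fractions of heavy points. -/
theorem isRCCoreset_of_heavy {ι : Type} [Fintype ι] [Nonempty ι] {k : ℕ} (hk : 1 ≤ k) {ε : ℝ}
    (hε : 0 ≤ ε) (P : ι → UncertainPoint k) {T : Finset ι} (hT : T.Nonempty)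
    (h : ∀ j < k, ∀ a b : ℝ, |((heavy P Finset.univ a b j).card : ℝ) / Fintype.card ι
      - ((heavy P T a b j).card : ℝ) / T.card| ≤ ε) :
    IsRCCoreset ε P twoSidedIntervals T := by
  refine ⟨hT, ?_⟩
  rintro r ⟨a, b, -, rfl⟩ τ ⟨-, hτ1⟩
  rw [rcFraction_Icc hk, rcFraction_subfamily_Icc hk]
  have hc : ⌈τ * k⌉₊ ≤ k := by
    rw [Nat.ceil_le]
    have : (0 : ℝ) ≤ k := by positivity
    nlinarith
  rcases hj : ⌈τ * k⌉₊ with _ | j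
  · -- For `τ = 0` both fractions are `1`.
    have h1 : (T.card : ℝ) ≠ 0 := by exact_mod_cast hT.card_pos.ne'
    simpa [h1] using hε
  · exact h j (by omega) a b

/-! ### The choice of the coreset size -/

theorem natLog_two_mul_log_two_le {k : ℕ} (hk : 1 ≤ k) :
    (Nat.log 2 k : ℝ) * Real.log 2 ≤ Real.log k := by
  have h1 : ((2 ^ Nat.log 2 k : ℕ) : ℝ) ≤ k := Nat.cast_le.mpr (Nat.pow_log_le_self 2 (by omega))
  rw [← Real.log_pow]
  apply Real.log_le_log (by positivity)
  exact_mod_cast h1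

/-- The number of points and the number of locations that remain after the last halving are
polynomial in `k / ε`, so their logarithms are of the order of `log (k / ε)`. -/
theorem log_size_le {k s : ℕ} {ε : ℝ} (hk : 1 ≤ k) (hε : 0 < ε) (hε1 : ε ≤ 1)
    (hkε : 2 ≤ (k : ℝ) / ε)
    (hs : (2 : ℝ) ^ s ≤ 2 ^ 37 * ((k : ℝ) ^ 2 / ε) * Real.log (k / ε) ^ 4) :
    (s + Nat.log 2 k + 8 : ℝ) ≤ 100 * Real.log (k / ε) := by
  have hk' : (1 : ℝ) ≤ k := by exact_mod_cast hk
  set L := Real.log (k / ε) with hL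
  have hlog2 : 0.69 < Real.log 2 := lt_trans (by norm_num) Real.log_two_gt_d9
  have hL2 : Real.log 2 ≤ L := Real.log_le_log two_pos hkε
  have hLpos : 0 < L := by linarith
  have hlogk : Real.log k ≤ L :=
    Real.log_le_log (by positivity) ((le_div_iff₀ hε).mpr (by nlinarith))
  have hsq : Real.log ((k : ℝ) ^ 2 / ε) ≤ 2 * L := by
    have h1 : (k : ℝ) ^ 2 / ε = k * (k / ε) := by ring
    rw [h1, Real.log_mul (by positivity) (by positivity)]
    linarith
  have h1 := Real.log_le_log (by positivity) hs
  rw [Real.log_mul (by positivity) (by positivity), Real.log_mul (by positivity) (by positivity),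
    Real.log_pow, Real.log_pow, Real.log_pow] at h1
  have hLL : Real.log L ≤ L := Real.log_le_self hLpos.le
  have h2 := natLog_two_mul_log_two_le hk
  push_cast at h1
  have h3 : (s + Nat.log 2 k + 8 : ℝ) * Real.log 2 ≤ 52 * L := by linarith
  have h4 : (0 : ℝ) ≤ s + Nat.log 2 k + 8 := by positivity
  nlinarith

theorem mainTheorem5 :
    ∃ C : ℝ, 0 < C ∧
      ∀ (k n : ℕ) (ε : ℝ), 1 ≤ k → 1 ≤ n → 0 < ε → ε ≤ 1 → 2 ≤ (k : ℝ) / ε →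
        ∀ P : Fin n → UncertainPoint k,
          ∃ T : Finset (Fin n),
            IsRCCoreset ε P twoSidedIntervals T ∧
              (T.card : ℝ) ≤ C * ((k : ℝ) ^ 2 / ε) * Real.log ((k : ℝ) / ε) ^ 4 := by
  refine ⟨2 ^ 37, by positivity, fun k n ε hk hn hε hε1 hkε P => ?_⟩
  have hk' : (1 : ℝ) ≤ k := by exact_mod_cast hk
  have : Nonempty (Fin n) := ⟨⟨0, hn⟩⟩
  set L := Real.log ((k : ℝ) / ε) with hL
  have hL2 : 0.69 < L := lt_of_lt_of_le (lt_trans (by norm_num) Real.log_two_gt_d9)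
    (Real.log_le_log two_pos hkε)
  have hLpos : 0 < L := by linarith
  -- The factor `2 ^ 36` exceeds `144 * 100 ^ 4`, which the error estimate `hE` below needs.
  set Y : ℝ := 2 ^ 36 * ((k : ℝ) ^ 2 / ε) * L ^ 4 with hY
  have hY1 : 1 ≤ Y := by
    have h1 : (1 : ℝ) ≤ (k : ℝ) ^ 2 / ε := by
      rw [le_div_iff₀ hε]
      nlinarith
    have h2 : (0.69 : ℝ) ^ 4 ≤ L ^ 4 := by gcongr
    calc (1 : ℝ) ≤ 2 ^ 36 * 1 * 0.69 ^ 4 := by norm_num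
      _ ≤ Y := by rw [hY]; gcongr
  -- The target size is the power of two `2 ^ (q + 1)` in the interval `(Y, 2 Y]`.
  obtain ⟨q, hq1, hq2⟩ := exists_nat_pow_near hY1 one_lt_two
  have hs : (2 : ℝ) ^ (q + 1) ≤ 2 ^ 37 * ((k : ℝ) ^ 2 / ε) * L ^ 4 := by
    calc (2 : ℝ) ^ (q + 1) = 2 * 2 ^ q := by ring
      _ ≤ 2 * Y := by gcongr
      _ = _ := by rw [hY]; ring
  rcases le_or_gt n (2 ^ (q + 1)) with hns | hns
  · refine ⟨Finset.univ, isRCCoreset_of_heavy hk hε.le P Finset.univ_nonempty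
      fun j _ a b => by simpa using hε.le, ?_⟩
    have h1 : ((Finset.univ : Finset (Fin n)).card : ℝ) ≤ 2 ^ (q + 1) := by
      rw [Finset.card_fin]
      exact_mod_cast hns
    exact h1.trans hs
  obtain ⟨m, hm1, hm2⟩ := exists_nat_pow_near hn one_lt_two
  have hqm : q + 1 < m + 1 := (Nat.pow_lt_pow_iff_right one_lt_two).mp (hns.trans hm2)
  obtain ⟨d, hd⟩ : ∃ d, m + 1 = q + 1 + d := ⟨m - q, by omega⟩
  obtain ⟨T, hT, hall, hheavy⟩ := exists_iterated_halving hk P d (q + 1) (by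
    rw [Fintype.card_fin, ← hd]; exact hm2.le)
  rw [Fintype.card_fin] at hall
  have hx := log_size_le hk hε hε1 hkε hs
  set x : ℝ := ((q + 1 : ℕ) : ℝ) + Nat.log 2 k + 8 with hxdef
  have hx0 : 0 ≤ x := by positivity
  have hn0 : (0 : ℝ) < n := by exact_mod_cast hn
  have hE : 2 * (2 ^ d * (36 * (k : ℝ) ^ 2 * x ^ 4)) / n ≤ ε := by
    have h1 : (2 : ℝ) ^ (q + 1) * 2 ^ d ≤ 2 * n := by
      rw [← pow_add, ← hd, pow_succ']
      exact_mod_cast Nat.mul_le_mul_left 2 hm1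
    have h2 : 144 * (k : ℝ) ^ 2 * x ^ 4 ≤ ε * 2 ^ (q + 1) := by
      calc 144 * (k : ℝ) ^ 2 * x ^ 4 ≤ 144 * (k : ℝ) ^ 2 * (100 * L) ^ 4 := by gcongr
        _ = 144 * 100 ^ 4 * ((k : ℝ) ^ 2 * L ^ 4) := by ring
        _ ≤ 2 ^ 36 * ((k : ℝ) ^ 2 * L ^ 4) := by gcongr; norm_num
        _ = ε * Y := by rw [hY]; field_simp
        _ ≤ ε * 2 ^ (q + 1) := by gcongr
    rw [div_le_iff₀ hn0]
    calc 2 * (2 ^ d * (36 * (k : ℝ) ^ 2 * x ^ 4)) = 2 ^ d * (144 * (k : ℝ) ^ 2 * x ^ 4) / 2 := by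
          ring
      _ ≤ 2 ^ d * (ε * 2 ^ (q + 1)) / 2 := by gcongr
      _ = ε * (2 ^ (q + 1) * 2 ^ d) / 2 := by ring
      _ ≤ ε * (2 * n) / 2 := by gcongr
      _ = ε * n := by ring
  -- An empty `T` would have error `n`, while the error is at most `ε n / 2`.
  have hTpos : 0 < T.card := by
    by_contra h0
    have h0' : (T.card : ℝ) = 0 := by exact_mod_cast Nat.eq_zero_of_not_pos h0
    rw [h0', mul_zero, zero_sub, abs_neg, abs_of_pos hn0] at hall
    rw [div_le_iff₀ hn0] at hE
    nlinarith
  refine ⟨T, isRCCoreset_of_heavy hk hε.le P (Finset.card_pos.mp hTpos) fun j hj a b => ?_, ?_⟩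
  · rw [Fintype.card_fin]
    exact (abs_div_sub_div_le hn0 (Nat.cast_pos.mpr hTpos) (Nat.cast_nonneg _)
      (Nat.cast_le.mpr (Finset.card_filter_le _ _)) hall (hheavy j hj a b)).trans hE
  · have h1 : (T.card : ℝ) ≤ 2 ^ (q + 1) := by exact_mod_cast hT
    exact h1.trans hs
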